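/- Let $b,s,m,z$ be non-negative integers with $1\le s<b$, $m\ge 4b$, $(2b-s)\nmid m$, $z\equiv m \pmod{2b-s}$ and $z\le b$. Put $t=2b-s$, $r=2^b$ and $$\ell=\frac{2^m-2^{t}(2^z-1)-1}{2^{t}-1}.$$ Then $\ell$ is a non-negative integer and $\mathbb F_2^m$ has a partial $t$-spread of size $\ell$, that is, $t$-dimensional subspaces $W_1,\dots,W_\ell$ with $W_i\cap W_j=\{0\}$ for $i\ne j$. Let $W_1,\dots,W_\ell$ be any such partial $t$-spread, let $G_{W_i}\in\mathbb F_2^{m\times t}$ be a matrix whose columns form a basis of $W_i$, let $G_U\in\mathbb F_2^{s\times s}$ be invertible, and let $A=\binom{A_1}{A_2}$ with $A_1\in\mathbb F_2^{s\times r}$, $A_2\in\mathbb F_2^{t\times r}$ be a desired matrix, i.e. $A$ has rank $s+t=2b$, any two columns of $A_2$ are linearly independent, and any four columns of $A$ are linearly independent. Set $$H_G^i=\left(\mathbf 0_{(s+m)\times 1},\ \begin{pmatrix}G_U&0\\0&G_{W_i}\end{pmatrix}A\right)\in\mathbb F_2^{(s+m)\times(r+1)},\qquad H=\begin{pmatrix}H_1&\cdots&H_\ell\\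 H_G^1&\cdots&H_G^\ell\end{pmatrix},$$ where $H_i\in\mathbb F_2^{\ell\times(r+1)}$ has all-one $i$-th row and zeros elsewhere. Then the binary linear code $\mathcal C$ with parity check matrix $H$ has length $n=(r+1)\ell$, dimension $k=n-\ell-s-m$ and minimum distance $d\ge 6$. It is locally repairable with locality $r=2^b$ (for every coordinate $i$ there is a set $R_i\not\ni i$ of at most $r$ coordinates with $c_i=\sum_{j\in R_i}c_j$ for all $c\in\mathcal C$), with disjoint local repair groups (the dual code contains $n/(r+1)$ words of weight $r+1$ with pairwise disjoint supports). Moreover $\mathcal C$ is $k$-optimal: $2\le r\le \frac n2-2$, and $k$ attains the bound $k\le\frac{rn}{r+1}-\min\{\log_2(1+\frac{rn}{2}),\frac{rn}{(r+1)(r+2)}\}$ for binary linear locally repairable codes with $d\ge5$, in the sense that $$k=\left\lfloor \frac{rn}{r+1}-\min\left\{\log_2\Bigl(1+\frac{rn}{2}\Bigr),\ \frac{rn}{(r+1)(r+2)}\right\}\right\rfloor .$$ -/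

import Mathlib

namespace BinLRC

/-- The binary linear code with parity check matrix `H`. -/
def parityCheckCode {ρ ι : Type*} [Fintype ι] (H : Matrix ρ ι (ZMod 2)) :
    Submodule (ZMod 2) (ι → ZMod 2) :=
  LinearMap.ker H.mulVecLin

/-- The minimum Hamming distance between distinct codewords (`0` if there are no two distinct
codewords, so that a positive lower bound also asserts that the code is not trivial). -/
noncomputable def minDist {ι : Type*} [Fintype ι] (C : Submodule (ZMod 2) (ι → ZMod 2)) : ℕ :=
  sInf {d : ℕ | ∃ x ∈ C, ∃ y ∈ C, x ≠ y ∧ hammingDist x y = d}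

/-- Locality `r`: every symbol is the sum of at most `r` other symbols, at fixed positions. -/
def HasLocality {ι : Type*} (C : Submodule (ZMod 2) (ι → ZMod 2)) (r : ℕ) : Prop :=
  ∀ i : ι, ∃ R : Finset ι, i ∉ R ∧ R.card ≤ r ∧ ∀ c ∈ C, c i = ∑ j ∈ R, c j

/-- `n / (r + 1)` words of the dual code, of weight `r + 1` and with pairwise disjoint supports. -/
def HasDisjointRepairGroups {ι : Type*} [Fintype ι] (C : Submodule (ZMod 2) (ι → ZMod 2))
    (r : ℕ) : Prop :=
  ∃ l : ℕ, Fintype.card ι = (r + 1) * l ∧ ∃ h : Fin l → ι → ZMod 2,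
    (∀ i, ∀ c ∈ C, h i ⬝ᵥ c = 0) ∧
    (∀ i, hammingNorm (h i) = r + 1) ∧
    Pairwise fun i j => Disjoint (Function.support (h i)) (Function.support (h j))

/-- The right-hand side of the explicit upper bound on the dimension of a binary linear LRC of
length `n` and locality `r` with minimum distance at least `5`, where `2 ≤ r ≤ n / 2 - 2`. -/
noncomputable def dimBound (n r : ℕ) : ℝ :=
  (r * n : ℝ) / (r + 1) -
    min (Real.logb 2 (1 + (r * n : ℝ) / 2)) ((r * n : ℝ) / ((r + 1) * (r + 2)))

/-- A binary linear LRC in the range of the bound whose dimension is the largest integer that the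
bound allows. -/
def IsKOptimal {ι : Type*} [Fintype ι] (C : Submodule (ZMod 2) (ι → ZMod 2)) (r : ℕ) : Prop :=
  HasLocality C r ∧ 5 ≤ minDist C ∧ 2 ≤ r ∧ (r : ℝ) ≤ (Fintype.card ι : ℝ) / 2 - 2 ∧
    (Module.finrank (ZMod 2) C : ℤ) = ⌊dimBound (Fintype.card ι) r⌋

/-- A partial `t`-spread of `F_2^m` of size `l`. -/
def IsPartialSpread {m l : ℕ} (t : ℕ) (W : Fin l → Submodule (ZMod 2) (Fin m → ZMod 2)) : Prop :=
  (∀ i, Module.finrank (ZMod 2) (W i) = t) ∧ Pairwise fun i j => W i ⊓ W j = ⊥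

/-- The matrix with upper part `A₁` and lower part `A₂` is a desired matrix. -/
structure IsDesired {s t r : ℕ} (A₁ : Matrix (Fin s) (Fin r) (ZMod 2))
    (A₂ : Matrix (Fin t) (Fin r) (ZMod 2)) : Prop where
  lt_two_pow : r < 2 ^ t
  lt_rows : s < t
  /-- any two columns of `A₂` (at different positions) are linearly independent -/
  two_cols : ∀ j : Fin 2 ↪ Fin r, LinearIndependent (ZMod 2) fun a => A₂.col (j a)
  /-- the rows of the whole matrix are linearly independent -/
  full_rank : (Matrix.fromRows A₁ A₂).rank = s + t
  /-- for `t ≥ 3`, any four columns of the whole matrix are linearly independent -/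
  four_cols : 3 ≤ t → ∀ j : Fin 4 ↪ Fin r,
    LinearIndependent (ZMod 2) fun a => (Matrix.fromRows A₁ A₂).col (j a)

/-- The matrix whose columns are the vectors of a given basis of the subspace `W`. -/
noncomputable def basisMatrix {m t : ℕ} {W : Submodule (ZMod 2) (Fin m → ZMod 2)}
    (e : Module.Basis (Fin t) (ZMod 2) W) : Matrix (Fin m) (Fin t) (ZMod 2) :=
  Matrix.of fun x j => (e j : Fin m → ZMod 2) x

/-- The block `(0, G_M * A)`, where `G_M` is block diagonal with blocks `GU` and `GW`. -/
def blockHG {s t m r : ℕ} (GU : Matrix (Fin s) (Fin s) (ZMod 2))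
    (GW : Matrix (Fin m) (Fin t) (ZMod 2)) (A : Matrix (Fin s ⊕ Fin t) (Fin r) (ZMod 2)) :
    Matrix (Fin s ⊕ Fin m) (Fin (r + 1)) (ZMod 2) :=
  Matrix.of fun x => Fin.cons 0 ((Matrix.fromBlocks GU 0 0 GW * A) x)

/-- The parity check matrix with `l` blocks of `r + 1` columns: column `(i, j)` has the `i`-th unit
vector above and column `j` of `HG i` below. -/
def parityCheckMatrix {l r : ℕ} {ρ : Type*} (HG : Fin l → Matrix ρ (Fin (r + 1)) (ZMod 2)) :
    Matrix (Fin l ⊕ ρ) (Fin l × Fin (r + 1)) (ZMod 2) :=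
  Matrix.fromRows (Matrix.of fun i p => if p.1 = i then 1 else 0)
    (Matrix.of fun x p => HG p.1 x p.2)

/-- The code of the construction, from an `s × s` matrix `GU`, subspaces `W i` with bases `e i`,
and the matrix with upper part `A₁` and lower part `A₂`. -/
noncomputable def spreadCode {s t m r l : ℕ} (GU : Matrix (Fin s) (Fin s) (ZMod 2))
    {W : Fin l → Submodule (ZMod 2) (Fin m → ZMod 2)}
    (e : ∀ i, Module.Basis (Fin t) (ZMod 2) (W i))
    (A₁ : Matrix (Fin s) (Fin r) (ZMod 2)) (A₂ : Matrix (Fin t) (Fin r) (ZMod 2)) :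
    Submodule (ZMod 2) (Fin l × Fin (r + 1) → ZMod 2) :=
  parityCheckCode
    (parityCheckMatrix fun i => blockHG GU (basisMatrix (e i)) (Matrix.fromRows A₁ A₂))

end BinLRC

/-!
Partial spreads grow by `t` dimensions at a time: in `K ^ t × L`, with `L / K` an extension of
degree `m ≥ t` and `φ : K ^ t → L` injective and linear, the graphs of `x ↦ a * φ x`, for `a` in
`L`, meet pairwise and meet the factor `L` only in `0`, so they can be added to any partial spread
of `L`.

A codeword has even weight in each block. If its weight is positive and below `6`, it therefore
lives either in one block, with weight at most `4`, which the independence of four columns of `A`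
forbids, or in two blocks, one of which has weight `2`. In the latter case `W i ⊓ W j = ⊥` makes
the lower half of the syndrome vanish on both blocks, against the independence of two columns of
`A₂`.

The spread covers more than half of `F_2 ^ m`, hence spans it, and so the rows of `H` are
independent. Finally, with `q = s + m` and `r = 2 ^ b`, the size of the spread gives
`2 ^ (q - 1) < 1 + r * n / 2 ≤ 2 ^ q`, while `r * n / ((r + 1) * (r + 2)) > q - 1`. So the minimum
in the bound lies in `(q - 1, q]`, whichever of its two terms is the smaller.
-/

namespace BinLRC

open Module Matrix

section PartialSpread

/-- `V` contains a partial `t`-spread of size `l`. This is `IsPartialSpread` over an arbitrary field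
and in an arbitrary vector space, so that spreads can be built inside extension fields. -/
def HasPartialSpread (K V : Type*) [Field K] [AddCommGroup V] [Module K V] (t l : ℕ) : Prop :=
  ∃ W : Fin l → Submodule K V,
    (∀ i, finrank K (W i) = t) ∧ Pairwise fun i j => Disjoint (W i) (W j)

section Module

variable {R M N : Type*} [Ring R] [AddCommGroup M] [Module R M] [AddCommGroup N] [Module R N]

theorem finrank_graph (f : M →ₗ[R] N) : finrank R f.graph = finrank R M := by
  rw [f.graph_eq_range_prod]
  exact LinearMap.finrank_range_of_inj fun _ _ h => congrArg Prod.fst h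

theorem disjoint_graph_map_inr (f : M →ₗ[R] N) (p : Submodule R N) :
    Disjoint f.graph (p.map (LinearMap.inr R M N)) := by
  rw [Submodule.disjoint_def]
  rintro _ h ⟨y, -, rfl⟩
  have hy : y = f 0 := (LinearMap.mem_graph_iff _ _).1 h
  simp [hy]

end Module

theorem disjoint_graph_mulLeft_comp {R L T : Type*} [CommRing R] [Ring L] [NoZeroDivisors L]
    [Algebra R L] [AddCommGroup T] [Module R T] {φ : T →ₗ[R] L} (hφ : Function.Injective φ)
    {a b : L} (hab : a ≠ b) :
    Disjoint (LinearMap.mulLeft R a ∘ₗ φ).graph (LinearMap.mulLeft R b ∘ₗ φ).graph := by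
  rw [Submodule.disjoint_def]
  rintro ⟨x, y⟩ ha hb
  replace ha : y = a * φ x := (LinearMap.mem_graph_iff _ _).1 ha
  replace hb : y = b * φ x := (LinearMap.mem_graph_iff _ _).1 hb
  have hmul : (a - b) * φ x = 0 := by rw [sub_mul, ← ha, ← hb, sub_self]
  have hx : x = 0 := (map_eq_zero_iff φ hφ).1
    ((mul_eq_zero.1 hmul).resolve_left (sub_ne_zero.2 hab))
  simp [hx, ha]

variable {K V V' : Type*} [Field K] [AddCommGroup V] [Module K V] [AddCommGroup V'] [Module K V']
  {t l : ℕ}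

theorem HasPartialSpread.of_family {ι : Type*} [Finite ι] {W : ι → Submodule K V}
    (hdim : ∀ i, finrank K (W i) = t) (hdisj : Pairwise fun i j => Disjoint (W i) (W j)) :
    HasPartialSpread K V t (Nat.card ι) :=
  ⟨W ∘ (Finite.equivFin ι).symm, fun _ => hdim _,
    hdisj.comp_of_injective (Finite.equivFin ι).symm.injective⟩

theorem HasPartialSpread.map {f : V →ₗ[K] V'} (hf : Function.Injective f)
    (h : HasPartialSpread K V t l) : HasPartialSpread K V' t l := by
  obtain ⟨W, hdim, hdisj⟩ := h
  exact ⟨fun i => (W i).map f,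
    fun i => (Submodule.equivMapOfInjective f hf _).finrank_eq.symm.trans (hdim i),
    fun _ _ hij => Submodule.disjoint_map hf (hdisj hij)⟩

theorem hasPartialSpread_one (ht : t ≤ finrank K V) : HasPartialSpread K V t 1 := by
  obtain ⟨v, hcard, hv⟩ := exists_finset_linearIndependent_of_le_finrank ht
  exact ⟨fun _ => Submodule.span K v, fun _ => (finrank_span_finset_eq_card hv).trans hcard,
    fun i j hij => (hij (Subsingleton.elim i j)).elim⟩

theorem HasPartialSpread.prod {L T : Type*} [Field L] [Finite L] [Algebra K L] [AddCommGroup T]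
    [Module K T] {φ : T →ₗ[K] L} (hφ : Function.Injective φ)
    (h : HasPartialSpread K L (finrank K T) l) :
    HasPartialSpread K (T × L) (finrank K T) (Nat.card L + l) := by
  obtain ⟨W, hdim, hdisj⟩ := h
  let U : L ⊕ Fin l → Submodule K (T × L) :=
    Sum.elim (fun a => (LinearMap.mulLeft K a ∘ₗ φ).graph)
      fun i => (W i).map (LinearMap.inr K T L)
  rw [← Nat.card_fin l, ← Nat.card_sum]
  refine .of_family (W := U) ?_ ?_
  · rintro (a | i)
    · exact finrank_graph _
    · rw [← hdim i]
      exact (Submodule.equivMapOfInjective _ LinearMap.inr_injective _).finrank_eq.symm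
  · rintro (a | i) (b | j) hij
    · exact disjoint_graph_mulLeft_comp hφ fun h => hij (congrArg _ h)
    · exact disjoint_graph_map_inr _ _
    · exact (disjoint_graph_map_inr _ _).symm
    · exact Submodule.disjoint_map LinearMap.inr_injective (hdisj fun h => hij (congrArg _ h))

theorem HasPartialSpread.fin_add [Finite K] {m : ℕ} (hm : m ≠ 0) (htm : t ≤ m)
    (h : HasPartialSpread K (Fin m → K) t l) :
    HasPartialSpread K (Fin (t + m) → K) t (Nat.card K ^ m + l) := by
  obtain ⟨p, _⟩ := CharP.exists K
  have : Fact p.Prime := ⟨CharP.char_is_prime K p⟩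
  have : NeZero m := ⟨hm⟩
  let L := FiniteField.Extension K p m
  have hL : finrank K L = m := FiniteField.finrank_extension K p m
  obtain ⟨φ, hφ⟩ : ∃ φ : (Fin t → K) →ₗ[K] L, Function.Injective φ :=
    finrank_le_iff_exists_linearMap.1 (by simpa [hL] using htm)
  have hspread : HasPartialSpread K L (finrank K (Fin t → K)) l := by
    rw [finrank_fin_fun]
    exact h.map (LinearEquiv.ofFinrankEq (Fin m → K) L (by simp [hL])).injective
  have hprod := hspread.prod hφ
  rw [finrank_fin_fun, FiniteField.natCard_extension] at hprod
  exact hprod.map (LinearEquiv.ofFinrankEq _ (Fin (t + m) → K) (by simp [hL])).injective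

theorem exists_hasPartialSpread (K : Type*) [Field K] [Finite K] {t : ℕ} (ht : t ≠ 0) (z k : ℕ) :
    ∃ l : ℕ, (l * (Nat.card K ^ t - 1) : ℤ) =
        Nat.card K ^ (t * (k + 1) + z) - Nat.card K ^ t * (Nat.card K ^ z - 1) - 1 ∧
      HasPartialSpread K (Fin (t * (k + 1) + z) → K) t l := by
  induction k with
  | zero => exact ⟨1, by push_cast; ring, hasPartialSpread_one (by simp)⟩
  | succ k ih =>
    obtain ⟨l, hl, hspread⟩ := ih
    have hdim : t * (k + 1 + 1) + z = t + (t * (k + 1) + z) := by ring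
    rw [hdim]
    refine ⟨_, ?_, hspread.fin_add (by positivity) (by nlinarith)⟩
    push_cast
    rw [add_mul, hl, pow_add _ t]
    ring

theorem hasPartialSpread_zmod_two_iff {m : ℕ} : HasPartialSpread (ZMod 2) (Fin m → ZMod 2) t l ↔
    ∃ W : Fin l → Submodule (ZMod 2) (Fin m → ZMod 2), IsPartialSpread t W := by
  simp only [HasPartialSpread, IsPartialSpread, disjoint_iff]

theorem sum_card_sub_one_lt_card {R M ι : Type*} [Semiring R] [AddCommMonoid M] [Module R M]
    [Finite M] [Fintype ι] {W : ι → Submodule R M} {S : Submodule R M} (hWS : ∀ i, W i ≤ S)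
    (hdisj : Pairwise fun i j => Disjoint (W i) (W j)) :
    ∑ i, (Nat.card (W i) - 1) < Nat.card S := by
  classical
  have hS : (S : Set M).Finite := Set.toFinite _
  let nonzero (i : ι) : Finset M := (Set.toFinite (W i : Set M)).toFinset.erase 0
  have hcard (i : ι) : (nonzero i).card = Nat.card (W i) - 1 := by
    rw [Finset.card_erase_of_mem (by simp), ← Nat.card_eq_card_finite_toFinset]
    rfl
  have hnonzero : ((Finset.univ : Finset ι) : Set ι).PairwiseDisjoint nonzero := by
    intro i _ j _ hij
    refine Finset.disjoint_left.2 fun x hi hj => ?_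
    simp only [nonzero, Finset.mem_erase, Set.Finite.mem_toFinset, SetLike.mem_coe] at hi hj
    exact hi.1 (Submodule.disjoint_def.1 (hdisj hij) x hi.2 hj.2)
  have hssub : Finset.univ.biUnion nonzero ⊂ hS.toFinset := by
    refine Finset.ssubset_iff_subset_ne.2 ⟨fun x hx => ?_, fun h => ?_⟩
    · obtain ⟨i, -, hi⟩ := Finset.mem_biUnion.1 hx
      simpa using hWS i (by simpa using Finset.mem_of_mem_erase hi)
    · have h0 : (0 : M) ∈ Finset.univ.biUnion nonzero := h ▸ by simp
      simp [nonzero] at h0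
  calc ∑ i, (Nat.card (W i) - 1) = (Finset.univ.biUnion nonzero).card := by
        simp only [Finset.card_biUnion hnonzero, hcard]
    _ < hS.toFinset.card := Finset.card_lt_card hssub
    _ = Nat.card S := (Nat.card_eq_card_finite_toFinset hS).symm

theorem two_mul_card_le_of_ne_top {R M : Type*} [Ring R] [AddCommGroup M] [Module R M] [Finite M]
    {S : Submodule R M} (hS : S ≠ ⊤) : 2 * Nat.card S ≤ Nat.card M := by
  have : Finite (M ⧸ S) := Finite.of_surjective _ S.mkQ_surjective
  have : Nontrivial (M ⧸ S) := Submodule.Quotient.nontrivial_iff.2 hS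
  rw [S.card_eq_card_quotient_mul_card, mul_comm]
  exact Nat.mul_le_mul_left _ Finite.one_lt_card

theorem iSup_eq_top_of_card_lt {R M ι : Type*} [Ring R] [AddCommGroup M] [Module R M] [Finite M]
    [Fintype ι] {W : ι → Submodule R M} (hdisj : Pairwise fun i j => Disjoint (W i) (W j))
    (hcard : Nat.card M < 2 * (∑ i, (Nat.card (W i) - 1) + 1)) : ⨆ i, W i = ⊤ := by
  by_contra hne
  have hlt := sum_card_sub_one_lt_card (S := ⨆ i, W i) (le_iSup W) hdisj
  have hle := two_mul_card_le_of_ne_top hne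
  omega

theorem IsPartialSpread.iSup_eq_top {m : ℕ} {W : Fin l → Submodule (ZMod 2) (Fin m → ZMod 2)}
    (hW : IsPartialSpread t W) (hcard : 2 ^ m < 2 * (l * (2 ^ t - 1) + 1)) : ⨆ i, W i = ⊤ := by
  refine iSup_eq_top_of_card_lt (hW.2.mono fun _ _ => disjoint_iff.2) ?_
  simpa [Module.natCard_eq_pow_finrank (K := ZMod 2), hW.1] using hcard

end PartialSpread

section LinearAlgebra

theorem linearIndependent_row_of_rank_eq_card {K m n : Type*} [Field K] [Fintype m] [Fintype n]
    {M : Matrix m n K} (hM : M.rank = Fintype.card m) : LinearIndependent K M.row := by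
  rw [linearIndependent_iff_card_eq_finrank_span, ← hM, M.rank_eq_finrank_span_row]
  rfl

theorem isUnit_of_rank_eq_card {K n : Type*} [Field K] [Fintype n] [DecidableEq n]
    {M : Matrix n n K} (hM : M.rank = Fintype.card n) : IsUnit M :=
  linearIndependent_rows_iff_isUnit.1 (linearIndependent_row_of_rank_eq_card hM)

theorem linearIndepOn_of_forall_embedding {R M ι : Type*} [Semiring R] [AddCommMonoid M]
    [Module R M] {k : ℕ} {v : ι → M}
    (hv : ∀ j : Fin k ↪ ι, LinearIndependent R fun a => v (j a)) {T : Finset ι}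
    (hT : T.card = k) : LinearIndepOn R v T := by
  let j : Fin k ↪ ι := (T.equivFinOfCardEq hT).symm.toEmbedding.trans (.subtype _)
  have hj : Set.range j = T := by
    ext i
    constructor
    · rintro ⟨a, rfl⟩
      exact ((T.equivFinOfCardEq hT).symm a).2
    · exact fun hi => ⟨T.equivFinOfCardEq hT ⟨i, hi⟩, by simp [j]⟩
  rw [← hj]
  exact (linearIndepOn_range_iff j.injective v).2 (hv j)

theorem eq_zero_of_mulVec_eq_zero_of_hammingNorm_le {K m n : Type*} [Field K] [DecidableEq K]
    [Fintype n] {k : ℕ} {A : Matrix m n K} (hk : k ≤ Fintype.card n)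
    (hA : ∀ j : Fin k ↪ n, LinearIndependent K fun a => A.col (j a)) {f : n → K}
    (hf : hammingNorm f ≤ k) (hAf : A *ᵥ f = 0) : f = 0 := by
  classical
  obtain ⟨T, hfT, hT⟩ := Finset.exists_superset_card_eq (s := {i | f i ≠ 0}) hf hk
  have hf0 : ∀ i, i ∉ T → f i = 0 := fun i hi => by
    by_contra h
    exact hi (hfT (by simpa using h))
  have hsum : ∑ i ∈ T, f i • A.col i = 0 := by
    rw [← hAf, Finset.sum_subset T.subset_univ fun i _ hi => by rw [hf0 i hi, zero_smul]]
    ext x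
    simp [mulVec, dotProduct, mul_comm]
  have hT0 := linearIndepOn_finset_iff.1 (linearIndepOn_of_forall_embedding hA hT) f hsum
  ext i
  by_cases hi : i ∈ T
  exacts [hT0 i hi, hf0 i hi]

variable {m t : ℕ} {W : Submodule (ZMod 2) (Fin m → ZMod 2)} (e : Basis (Fin t) (ZMod 2) W)

theorem basisMatrix_mulVec (v : Fin t → ZMod 2) : basisMatrix e *ᵥ v = e.equivFun.symm v := by
  ext x
  simp [Basis.equivFun_symm_apply, basisMatrix, mulVec, dotProduct, mul_comm]

theorem basisMatrix_mulVec_mem (v : Fin t → ZMod 2) : basisMatrix e *ᵥ v ∈ W := by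
  rw [basisMatrix_mulVec]
  exact Subtype.prop _

theorem basisMatrix_mulVec_injective : Function.Injective (basisMatrix e).mulVec := by
  rw [funext (basisMatrix_mulVec e)]
  exact Subtype.val_injective.comp e.equivFun.symm.injective

theorem eq_zero_of_vecMul_basisMatrix_eq_zero {ι : Type*}
    {W : ι → Submodule (ZMod 2) (Fin m → ZMod 2)} {e : ∀ i, Basis (Fin t) (ZMod 2) (W i)}
    (hW : ⨆ i, W i = ⊤) {v : Fin m → ZMod 2} (hv : ∀ i, v ᵥ* basisMatrix (e i) = 0) : v = 0 := by
  have hle : ⨆ i, W i ≤ LinearMap.ker (dotProductBilin (ZMod 2) (ZMod 2) v) := by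
    refine iSup_le fun i x hx => ?_
    obtain ⟨w, rfl⟩ : ∃ w, basisMatrix (e i) *ᵥ w = x :=
      ⟨(e i).equivFun ⟨x, hx⟩, by simp [basisMatrix_mulVec]⟩
    change v ⬝ᵥ basisMatrix (e i) *ᵥ w = 0
    rw [dotProduct_mulVec, hv, zero_dotProduct]
  exact dotProduct_eq_zero v fun w => hle (hW ▸ Submodule.mem_top)

end LinearAlgebra

section HammingWeight

theorem even_hammingNorm_of_sum_eq_zero {ι : Type*} [Fintype ι] {f : ι → ZMod 2}
    (hf : ∑ i, f i = 0) : Even (hammingNorm f) := by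
  have hind : ∀ a : ZMod 2, ((if a ≠ 0 then 1 else 0 : ℕ) : ZMod 2) = a := by decide
  rw [← ZMod.natCast_eq_zero_iff_even, hammingNorm, Finset.card_filter, Nat.cast_sum]
  simpa only [hind] using hf

theorem hammingNorm_eq_sum_prod {ι κ M : Type*} [Fintype ι] [Fintype κ] [Zero M] [DecidableEq M]
    (c : ι × κ → M) : hammingNorm c = ∑ i, hammingNorm fun j => c (i, j) := by
  simp only [hammingNorm, Finset.card_filter, Fintype.sum_prod_type]

theorem hammingNorm_tail_le {M : Type*} [Zero M] [DecidableEq M] {r : ℕ} (f : Fin (r + 1) → M) :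
    hammingNorm (Fin.tail f) ≤ hammingNorm f := by
  rw [hammingNorm, hammingNorm, Finset.card_filter, Finset.card_filter, Fin.sum_univ_succ]
  exact Nat.le_add_left _ _

theorem eq_zero_of_tail_eq_zero {M : Type*} [AddCommMonoid M] {r : ℕ} {f : Fin (r + 1) → M}
    (hf : ∑ j, f j = 0) (htail : Fin.tail f = 0) : f = 0 := by
  have hsucc : ∀ j : Fin r, f j.succ = 0 := congrFun htail
  have hzero : f 0 = 0 := by simpa [Fin.sum_univ_succ, hsucc] using hf
  exact funext (Fin.cases hzero hsucc)

theorem exists_support_of_even_of_sum_lt_six {ι : Type*} [Fintype ι] {w : ι → ℕ}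
    (heven : ∀ i, Even (w i)) (hlt : ∑ i, w i < 6) (hw : ∃ i, w i ≠ 0) :
    (∃ i, w i ≠ 0 ∧ w i ≤ 4 ∧ ∀ j, j ≠ i → w j = 0) ∨
      ∃ i k, i ≠ k ∧ w i = 2 ∧ ∀ j, j ≠ i ∧ j ≠ k → w j = 0 := by
  classical
  have hle (T : Finset ι) : ∑ i ∈ T, w i < 6 :=
    (Finset.sum_le_sum_of_subset T.subset_univ).trans_lt hlt
  obtain ⟨i, hi⟩ := hw
  by_cases hex : ∃ k, k ≠ i ∧ w k ≠ 0
  · obtain ⟨k, hki, hk⟩ := hex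
    have hik := hle {i, k}
    rw [Finset.sum_pair hki.symm] at hik
    refine .inr ⟨i, k, hki.symm, by grind, fun j ⟨hji, hjk⟩ => ?_⟩
    have hijk := hle {i, k, j}
    rw [Finset.sum_insert (by simp [hki.symm, hji.symm]), Finset.sum_pair hjk.symm] at hijk
    grind
  · push Not at hex
    have hi6 := hle {i}
    rw [Finset.sum_singleton] at hi6
    exact .inl ⟨i, hi, by grind, hex⟩

theorem le_minDist {ι : Type*} [Fintype ι] {C : Submodule (ZMod 2) (ι → ZMod 2)} {d : ℕ}
    (hC : C ≠ ⊥) (hd : ∀ c ∈ C, c ≠ 0 → d ≤ hammingNorm c) : d ≤ minDist C := by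
  obtain ⟨x, hx, hx0⟩ := C.ne_bot_iff.1 hC
  refine le_csInf ⟨_, x, hx, 0, C.zero_mem, hx0, rfl⟩ ?_
  rintro _ ⟨x, hx, y, hy, hxy, rfl⟩
  rw [hammingDist_eq_hammingNorm, neg_add_eq_sub]
  exact hd _ (C.sub_mem hy hx) (sub_ne_zero.2 hxy.symm)

end HammingWeight

section ParityCheckMatrix

theorem finrank_parityCheckCode_add_card {ρ ι : Type*} [Fintype ρ] [Fintype ι]
    {H : Matrix ρ ι (ZMod 2)} (hH : LinearIndependent (ZMod 2) H.row) :
    finrank (ZMod 2) (parityCheckCode H) + Fintype.card ρ = Fintype.card ι := by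
  rw [← hH.rank_matrix, add_comm, ← Module.finrank_fintype_fun_eq_card (ZMod 2)]
  exact H.mulVecLin.finrank_range_add_finrank_ker

variable {l r : ℕ} {ρ : Type*} {HG : Fin l → Matrix ρ (Fin (r + 1)) (ZMod 2)}
  {c : Fin l × Fin (r + 1) → ZMod 2}

theorem mem_parityCheckCode_parityCheckMatrix :
    c ∈ parityCheckCode (parityCheckMatrix HG) ↔
      (∀ i, ∑ j, c (i, j) = 0) ∧ ∑ i, HG i *ᵥ (fun j => c (i, j)) = 0 := by
  have hupper (i : Fin l) : (parityCheckMatrix HG *ᵥ c) (.inl i) = ∑ j, c (i, j) := by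
    simp only [parityCheckMatrix, mulVec, dotProduct, Fintype.sum_prod_type, fromRows_apply_inl,
      of_apply, ite_mul, one_mul, zero_mul]
    rw [Finset.sum_comm]
    simp
  have hlower (x : ρ) : (parityCheckMatrix HG *ᵥ c) (.inr x) =
      (∑ i, HG i *ᵥ fun j => c (i, j)) x := by
    simp [parityCheckMatrix, mulVec, dotProduct, Fintype.sum_prod_type, Finset.sum_apply]
  rw [parityCheckCode, LinearMap.mem_ker, mulVecLin_apply, funext_iff, Sum.forall, funext_iff]
  simp only [hupper, hlower, Pi.zero_apply]

theorem hasLocality_parityCheckMatrix :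
    HasLocality (parityCheckCode (parityCheckMatrix HG)) r := by
  rintro ⟨i, j⟩
  refine ⟨(Finset.univ.erase j).map (.sectR i _), by simp, by simp, fun c hc => ?_⟩
  have hsum := (mem_parityCheckCode_parityCheckMatrix.1 hc).1 i
  rw [← Finset.add_sum_erase _ _ (Finset.mem_univ j), CharTwo.add_eq_zero] at hsum
  rw [hsum, Finset.sum_map]
  rfl

theorem hasDisjointRepairGroups_parityCheckMatrix :
    HasDisjointRepairGroups (parityCheckCode (parityCheckMatrix HG)) r := by
  refine ⟨l, by simp [mul_comm], fun i p => if p.1 = i then 1 else 0, fun i c hc => ?_,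
    fun i => ?_, fun i k hik => Set.disjoint_left.2 fun p hpi hpk => hik ?_⟩
  · exact congrFun (LinearMap.mem_ker.1 hc) (.inl i)
  · have hblock (k : Fin l) :
        (hammingNorm fun _ : Fin (r + 1) => if k = i then (1 : ZMod 2) else 0) =
          if k = i then r + 1 else 0 := by
      split_ifs <;> simp [hammingNorm]
    simp [hammingNorm_eq_sum_prod, hblock]
  · have hi : p.1 = i := by simpa using hpi
    have hk : p.1 = k := by simpa using hpk
    exact hi.symm.trans hk

/-- The zero column of each block isolates the coefficient of the corresponding unit row. -/
theorem linearIndependent_row_parityCheckMatrix [Fintype ρ] (hzero : ∀ i x, HG i x 0 = 0)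
    (hHG : ∀ v, (∀ i, v ᵥ* HG i = 0) → v = 0) :
    LinearIndependent (ZMod 2) (parityCheckMatrix HG).row := by
  rw [← vecMul_injective_iff, ← coe_vecMulLinear, injective_iff_map_eq_zero]
  intro v hv
  have hcol (i j) : v (.inl i) + ((v ∘ .inr) ᵥ* HG i) j = 0 := by
    simpa [parityCheckMatrix, vecMul, dotProduct] using congrFun hv (i, j)
  have hupper (i) : v (.inl i) = 0 := by
    simpa [vecMul, dotProduct, hzero] using hcol i 0
  have hlower : v ∘ .inr = 0 := hHG _ fun i => funext fun j => by
    simpa [hupper] using hcol i j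
  exact funext (Sum.rec hupper (congrFun hlower))

theorem six_le_hammingNorm_of_mem_parityCheckMatrix
    (hone : ∀ i (f : Fin (r + 1) → ZMod 2), ∑ j, f j = 0 → hammingNorm f ≤ 4 →
      HG i *ᵥ f = 0 → f = 0)
    (htwo : ∀ i k, i ≠ k → ∀ f g : Fin (r + 1) → ZMod 2, ∑ j, f j = 0 → hammingNorm f ≤ 2 →
      HG i *ᵥ f + HG k *ᵥ g = 0 → f = 0)
    (hc : c ∈ parityCheckCode (parityCheckMatrix HG)) (hc0 : c ≠ 0) : 6 ≤ hammingNorm c := by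
  obtain ⟨hpar, hsum⟩ := mem_parityCheckCode_parityCheckMatrix.1 hc
  let block (i : Fin l) : Fin (r + 1) → ZMod 2 := fun j => c (i, j)
  by_contra! hlt
  rw [hammingNorm_eq_sum_prod] at hlt
  have hne : ∃ i, hammingNorm (block i) ≠ 0 := by
    by_contra! h
    exact hc0 (funext fun p => congrFun (hammingNorm_eq_zero.1 (h p.1)) p.2)
  have hvanish (i) (hi : hammingNorm (block i) = 0) : HG i *ᵥ block i = 0 := by
    rw [hammingNorm_eq_zero.1 hi, mulVec_zero]
  obtain ⟨i, hi, hi4, hrest⟩ | ⟨i, k, hik, hi, hrest⟩ := exists_support_of_even_of_sum_lt_six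
    (fun i => even_hammingNorm_of_sum_eq_zero (hpar i)) hlt hne
  · rw [Fintype.sum_eq_single i fun j hj => hvanish j (hrest j hj)] at hsum
    exact hi (hammingNorm_eq_zero.2 (hone i _ (hpar i) hi4 hsum))
  · rw [Fintype.sum_eq_add i k hik fun j hj => hvanish j (hrest j hj)] at hsum
    have hblock : block i = 0 := htwo i k hik _ _ (hpar i) hi.le hsum
    simp [block, hblock] at hi

end ParityCheckMatrix

section BlockHG

variable {s t m r : ℕ} {GU : Matrix (Fin s) (Fin s) (ZMod 2)} {GW : Matrix (Fin m) (Fin t) (ZMod 2)}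
  {A₁ : Matrix (Fin s) (Fin r) (ZMod 2)} {A₂ : Matrix (Fin t) (Fin r) (ZMod 2)}

theorem blockHG_mulVec (f : Fin (r + 1) → ZMod 2) : blockHG GU GW (fromRows A₁ A₂) *ᵥ f =
    Sum.elim (GU *ᵥ (A₁ *ᵥ Fin.tail f)) (GW *ᵥ (A₂ *ᵥ Fin.tail f)) := by
  simp only [mulVec_mulVec]
  ext (x | x) <;>
    simp [blockHG, mulVec, dotProduct, Fin.sum_univ_succ, fromBlocks_mul_fromRows, Fin.tail]

theorem tail_vecMul_blockHG (A : Matrix (Fin s ⊕ Fin t) (Fin r) (ZMod 2))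
    (v : Fin s ⊕ Fin m → ZMod 2) : Fin.tail (v ᵥ* blockHG GU GW A) =
      Sum.elim ((v ∘ .inl) ᵥ* GU) ((v ∘ .inr) ᵥ* GW) ᵥ* A := by
  have h : Sum.elim ((v ∘ .inl) ᵥ* GU) ((v ∘ .inr) ᵥ* GW) = v ᵥ* fromBlocks GU 0 0 GW := by
    simp [vecMul_fromBlocks]
  rw [h, vecMul_vecMul]
  ext j
  simp [blockHG, vecMul, dotProduct, Fin.tail]

end BlockHG

section SpreadCode

variable {s t m r l : ℕ} {GU : Matrix (Fin s) (Fin s) (ZMod 2)}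
  {W : Fin l → Submodule (ZMod 2) (Fin m → ZMod 2)} {e : ∀ i, Basis (Fin t) (ZMod 2) (W i)}
  {A₁ : Matrix (Fin s) (Fin r) (ZMod 2)} {A₂ : Matrix (Fin t) (Fin r) (ZMod 2)}

theorem eq_zero_of_vecMul_blockHG_eq_zero [Nonempty (Fin l)] (hW : ⨆ i, W i = ⊤) (hGU : IsUnit GU)
    (hA : LinearIndependent (ZMod 2) (fromRows A₁ A₂).row) {v : Fin s ⊕ Fin m → ZMod 2}
    (hv : ∀ i, v ᵥ* blockHG GU (basisMatrix (e i)) (fromRows A₁ A₂) = 0) : v = 0 := by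
  have hblocks (i) : Sum.elim ((v ∘ .inl) ᵥ* GU) ((v ∘ .inr) ᵥ* basisMatrix (e i)) = 0 := by
    refine vecMul_injective_iff.2 hA (Eq.trans ?_ (zero_vecMul _).symm)
    refine (tail_vecMul_blockHG _ v).symm.trans ?_
    rw [hv]
    rfl
  have hinl : v ∘ .inl = 0 := by
    obtain ⟨i⟩ := ‹Nonempty (Fin l)›
    refine vecMul_injective_of_isUnit hGU (Eq.trans ?_ (zero_vecMul _).symm)
    exact funext fun x => congrFun (hblocks i) (.inl x)
  have hinr : v ∘ .inr = 0 :=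
    eq_zero_of_vecMul_basisMatrix_eq_zero hW fun i => funext fun x => congrFun (hblocks i) (.inr x)
  exact funext (Sum.rec (congrFun hinl) (congrFun hinr))

theorem finrank_spreadCode_add [Nonempty (Fin l)] (hW : ⨆ i, W i = ⊤) (hGU : GU.rank = s)
    (hA : (fromRows A₁ A₂).rank = s + t) :
    finrank (ZMod 2) (spreadCode GU e A₁ A₂) + (l + (s + m)) = l * (r + 1) := by
  have hrowsA := linearIndependent_row_of_rank_eq_card (M := fromRows A₁ A₂) (by simpa using hA)
  have hrows := linearIndependent_row_parityCheckMatrix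
    (HG := fun i => blockHG GU (basisMatrix (e i)) (fromRows A₁ A₂)) (fun _ _ => rfl)
    fun _ => eq_zero_of_vecMul_blockHG_eq_zero hW (isUnit_of_rank_eq_card (by simpa)) hrowsA
  have hfinrank := finrank_parityCheckCode_add_card hrows
  simp only [Fintype.card_sum, Fintype.card_prod, Fintype.card_fin] at hfinrank
  exact hfinrank

theorem six_le_hammingNorm_of_mem_spreadCode (hW : IsPartialSpread t W) (hGU : GU.rank = s)
    (hA : IsDesired A₁ A₂) (ht : 3 ≤ t) (hr : 4 ≤ r) {c : Fin l × Fin (r + 1) → ZMod 2}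
    (hc : c ∈ spreadCode GU e A₁ A₂) (hc0 : c ≠ 0) : 6 ≤ hammingNorm c := by
  have hker (i) {v} (hv : basisMatrix (e i) *ᵥ v = 0) : v = 0 :=
    basisMatrix_mulVec_injective (e i) (hv.trans (mulVec_zero _).symm)
  refine six_le_hammingNorm_of_mem_parityCheckMatrix (fun i f hf hf4 h => ?_)
    (fun i k hik f g hf hf2 h => ?_) hc hc0
  · rw [blockHG_mulVec, ← Sum.elim_zero_zero, Sum.elim_eq_iff] at h
    have hA₁ : A₁ *ᵥ Fin.tail f = 0 :=
      mulVec_injective_of_isUnit (isUnit_of_rank_eq_card (by simpa))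
        (h.1.trans (mulVec_zero _).symm)
    have hA₂ : A₂ *ᵥ Fin.tail f = 0 := hker i h.2
    refine eq_zero_of_tail_eq_zero hf (eq_zero_of_mulVec_eq_zero_of_hammingNorm_le
      (by simpa using hr) (hA.four_cols ht) ((hammingNorm_tail_le f).trans hf4) ?_)
    rw [fromRows_mulVec, hA₁, hA₂, Sum.elim_zero_zero]
  · have hsum : basisMatrix (e i) *ᵥ (A₂ *ᵥ Fin.tail f) +
        basisMatrix (e k) *ᵥ (A₂ *ᵥ Fin.tail g) = 0 := by
      simp only [blockHG_mulVec] at h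
      exact funext fun x => congrFun h (.inr x)
    have hmem : basisMatrix (e i) *ᵥ (A₂ *ᵥ Fin.tail f) ∈ W i ⊓ W k := by
      refine ⟨basisMatrix_mulVec_mem _ _, ?_⟩
      rw [eq_neg_of_add_eq_zero_left hsum]
      exact neg_mem (basisMatrix_mulVec_mem _ _)
    rw [hW.2 hik, Submodule.mem_bot] at hmem
    exact eq_zero_of_tail_eq_zero hf (eq_zero_of_mulVec_eq_zero_of_hammingNorm_le
      (by simp; omega) hA.two_cols ((hammingNorm_tail_le f).trans hf2) (hker i hmem))

end SpreadCode

section Arithmetic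

-- The capitals stand for `2 ^ b`, `2 ^ s`, `2 ^ t`, `2 ^ m`, `2 ^ z` and `2 ^ (m - t)`, where
-- `t = 2 * b - s`; the equation for `l * (T - 1)` is the size of the spread.

variable {R : Type*} [CommRing R] [LinearOrder R] [IsStrictOrderedRing R] {B S T M Z U l : R}

theorem add_one_le_of_mul_sub_one_eq (hT : 1 < T) (hTZ : T * Z ≤ U)
    (hl : l * (T - 1) = U * T - T * (Z - 1) - 1) : U + 1 ≤ l := by
  refine le_of_mul_le_mul_right ?_ (sub_pos.2 hT)
  linarith

theorem mul_add_two_le_two_mul_of_mul_sub_one_eq (hB : 2 ≤ B) (hS : 1 ≤ S) (hSB : 2 * S ≤ B)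
    (hT : 1 < T) (hST : S * T = B ^ 2) (hZ : 1 ≤ Z) (hM : 1 ≤ M)
    (hl : l * (T - 1) = M - T * (Z - 1) - 1) : B * (B + 1) * l + 2 ≤ 2 * (S * M) := by
  have hlM : l * (T - 1) ≤ M - 1 := by nlinarith
  have hBT : B * (B + 1) ≤ 2 * S * (T - 1) := by nlinarith
  suffices B * (B + 1) * l ≤ 2 * S * (M - 1) by linarith
  refine le_of_mul_le_mul_right ?_ (sub_pos.2 hT)
  calc B * (B + 1) * l * (T - 1) = B * (B + 1) * (l * (T - 1)) := mul_assoc _ _ _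
    _ ≤ B * (B + 1) * (M - 1) := by gcongr
    _ ≤ 2 * S * (T - 1) * (M - 1) := mul_le_mul_of_nonneg_right hBT (sub_nonneg.2 hM)
    _ = 2 * S * (M - 1) * (T - 1) := by ring

theorem mul_lt_mul_add_two_of_mul_sub_one_eq (hB : 0 ≤ B) (hS : 1 ≤ S) (hT : 1 < T)
    (hST : S * T = B ^ 2) (hM : 0 ≤ M) (hBM : B * (T * Z) ≤ M)
    (hl : l * (T - 1) = M - T * (Z - 1) - 1) : S * M < B * (B + 1) * l + 2 := by
  have hT' : 0 < T - 1 := sub_pos.2 hT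
  have hSM : M ≤ S * M := le_mul_of_one_le_left hM hS
  have hBM' : (B + 1) * (B * (T * Z)) ≤ (B + 1) * M := by gcongr
  refine lt_of_mul_lt_mul_right ?_ hT'.le
  calc S * M * (T - 1) = B ^ 2 * M - S * M := by linear_combination M * hST
    _ ≤ B * (B + 1) * M - (B + 1) * (B * (T * Z)) := by linarith
    _ < B * (B + 1) * M - (B + 1) * (B * (T * Z)) + (B * (B + 1) + 2) * (T - 1) :=
      lt_add_of_pos_right _ (by positivity)
    _ = (B * (B + 1) * l + 2) * (T - 1) := by linear_combination -(B * (B + 1)) * hl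

theorem nine_mul_le_two_pow_succ_add_nine {u : ℕ} (hu : 4 ≤ u) : 9 * u ≤ 2 ^ (u + 1) + 9 := by
  induction u, hu using Nat.le_induction with
  | base => norm_num
  | succ u hu ih => rw [pow_succ]; omega

theorem exists_eq_mul_add_of_modEq {t m z : ℕ} (hz : z ≡ m [MOD t]) (hm : t + z < m) :
    ∃ k, m = t * (k + 1 + 1) + z := by
  obtain ⟨d, hd⟩ : t ∣ m - (t + z) :=
    (Nat.modEq_iff_dvd' hm.le).1 (by simpa only [Nat.ModEq, Nat.add_mod_left] using hz)
  obtain ⟨k, rfl⟩ : ∃ k, d = k + 1 := Nat.exists_eq_add_one_of_ne_zero fun hd0 => by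
    rw [hd0, mul_zero] at hd
    omega
  exact ⟨k, by rw [mul_add_one]; omega⟩

end Arithmetic

section DimBound

theorem floor_dimBound {r l k : ℕ} (hle : r * (r + 1) * l + 2 ≤ 2 * 2 ^ k)
    (hlt : 2 ^ k < r * (r + 1) * l + 2) (hk : k * (r + 2) < r * l + (r + 2)) :
    ⌊dimBound ((r + 1) * l) r⌋ = (r * l : ℤ) - k := by
  have hle' : (r * (r + 1) * l + 2 : ℝ) ≤ 2 * 2 ^ k := by exact_mod_cast hle
  have hlt' : (2 ^ k : ℝ) < r * (r + 1) * l + 2 := by exact_mod_cast hlt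
  have hk' : (k * (r + 2) : ℝ) < r * l + (r + 2) := by exact_mod_cast hk
  have hpos : (0 : ℝ) < 1 + r * ((r + 1) * l) / 2 := by positivity
  have hsize : (r * ((r + 1) * l) / (r + 1) : ℝ) = r * l := by field_simp
  have hratio : (r * ((r + 1) * l) / ((r + 1) * (r + 2)) : ℝ) = r * l / (r + 2) := by field_simp
  have hlog_le : Real.logb 2 (1 + r * ((r + 1) * l) / 2) ≤ k := by
    rw [Real.logb_le_iff_le_rpow one_lt_two hpos, Real.rpow_natCast]
    linarith
  have hlt_log : (k - 1 : ℝ) < Real.logb 2 (1 + r * ((r + 1) * l) / 2) := by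
    rw [Real.lt_logb_iff_rpow_lt one_lt_two hpos, Real.rpow_sub_one two_ne_zero, Real.rpow_natCast]
    linarith
  have hlt_ratio : (k - 1 : ℝ) < r * l / (r + 2) := by
    rw [lt_div_iff₀ (by positivity)]
    linarith
  rw [Int.floor_eq_iff, dimBound]
  push_cast
  rw [hsize, hratio]
  have hmin_le := (min_le_left _ (r * l / (r + 2) : ℝ)).trans hlog_le
  have hlt_min := lt_min hlt_log hlt_ratio
  constructor <;> linarith

variable {b s t m z l : ℕ}

theorem two_pow_sub_lt_of_mul_sub_one_eq (ht : t ≠ 0) (hm : 2 * t + z ≤ m)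
    (hl : (l * (2 ^ t - 1) : ℤ) = 2 ^ m - 2 ^ t * (2 ^ z - 1) - 1) : 2 ^ (m - t) < l := by
  have hT : (1 : ℤ) < 2 ^ t := one_lt_pow₀ one_lt_two ht
  have hTZ : (2 ^ t * 2 ^ z : ℤ) ≤ 2 ^ (m - t) := by
    rw [← pow_add]
    exact pow_le_pow_right₀ one_le_two (by omega)
  rw [show m = m - t + t by omega, pow_add] at hl
  exact_mod_cast add_one_le_of_mul_sub_one_eq hT hTZ hl

theorem two_pow_lt_two_mul_of_two_pow_sub_lt (ht : t ≠ 0) (htm : t ≤ m) (hl : 2 ^ (m - t) < l) :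
    2 ^ m < 2 * (l * (2 ^ t - 1) + 1) := by
  have hT : 2 ≤ 2 ^ t := Nat.le_self_pow ht 2
  have hM : 2 ^ m = 2 ^ (m - t) * 2 ^ t := by rw [← pow_add, Nat.sub_add_cancel htm]
  obtain ⟨T, hT'⟩ : ∃ T, 2 ^ t = T + 2 := Nat.exists_eq_add_of_le' hT
  rw [hM, hT', show T + 2 - 1 = T + 1 from rfl]
  nlinarith [Nat.mul_le_mul_right (T + 1) hl]

theorem redundancy_mul_lt (hb : 2 ≤ b) (hsb : s < b) (hst : s + t = 2 * b) (hm : 2 * t ≤ m)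
    (hm7 : 7 ≤ m) (hl : 2 ^ (m - t) < l) :
    (s + m) * (2 ^ b + 2) < 2 ^ b * l + (2 ^ b + 2) := by
  obtain ⟨u, rfl⟩ := Nat.exists_eq_add_of_le (show t ≤ m by omega)
  rw [Nat.add_sub_cancel_left] at hl
  have hB : 4 ≤ 2 ^ b := Nat.pow_le_pow_right two_pos hb
  have hu := nine_mul_le_two_pow_succ_add_nine (show 4 ≤ u by omega)
  have hred : s + (t + u) + 2 ≤ 3 * u := by omega
  rw [pow_succ] at hu
  -- `2 * (s + m - 1) * (B + 2) ≤ 6 * (u - 1) * (B + 2) ≤ 9 * (u - 1) * B < 2 * l * B`, `B = 2 ^ b`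
  nlinarith

theorem add_lt_two_pow_mul (hb : 2 ≤ b) (hsb : s < b) (hst : s + t = 2 * b) (hm : 2 * t ≤ m)
    (hm7 : 7 ≤ m) (hl : 2 ^ (m - t) < l) : s + m < 2 ^ b * l := by
  have hred := redundancy_mul_lt hb hsb hst hm hm7 hl
  nlinarith [Nat.one_le_two_pow (n := m - t), Nat.one_le_two_pow (n := b)]

theorem floor_dimBound_of_mul_sub_one_eq (hb : 2 ≤ b) (hsb : s < b) (hst : s + t = 2 * b)
    (hm : 2 * t + z ≤ m) (hm7 : 7 ≤ m)
    (hl : (l * (2 ^ t - 1) : ℤ) = 2 ^ m - 2 ^ t * (2 ^ z - 1) - 1) :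
    ⌊dimBound ((2 ^ b + 1) * l) (2 ^ b)⌋ = (2 ^ b * l - (s + m) : ℤ) := by
  have hB : (2 : ℤ) ≤ 2 ^ b := le_self_pow₀ one_le_two (by omega)
  have hS : (1 : ℤ) ≤ 2 ^ s := one_le_pow₀ one_le_two
  have hSB : 2 * 2 ^ s ≤ (2 ^ b : ℤ) := by
    rw [← pow_succ']
    exact pow_le_pow_right₀ one_le_two hsb
  have hT : (1 : ℤ) < 2 ^ t := one_lt_pow₀ one_lt_two (by omega)
  have hST : (2 ^ s * 2 ^ t : ℤ) = (2 ^ b) ^ 2 := by rw [← pow_add, ← pow_mul, hst, mul_comm]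
  have hM : (1 : ℤ) ≤ 2 ^ m := one_le_pow₀ one_le_two
  have hBM : (2 ^ b * (2 ^ t * 2 ^ z) : ℤ) ≤ 2 ^ m := by
    rw [← pow_add, ← pow_add]
    exact pow_le_pow_right₀ one_le_two (by omega)
  have hupper :=
    mul_add_two_le_two_mul_of_mul_sub_one_eq hB hS hSB hT hST (one_le_pow₀ one_le_two) hM hl
  have hlower :=
    mul_lt_mul_add_two_of_mul_sub_one_eq (by positivity) hS hT hST (by positivity) hBM hl
  rw [← pow_add] at hupper hlower
  have hred := redundancy_mul_lt hb hsb hst (by omega) hm7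
    (two_pow_sub_lt_of_mul_sub_one_eq (by omega) hm hl)
  exact_mod_cast floor_dimBound (by exact_mod_cast hupper) (by exact_mod_cast hlower) hred

end DimBound

section Optimality

theorem isKOptimal_of_finrank_eq_floor_dimBound {l r : ℕ}
    {C : Submodule (ZMod 2) (Fin l × Fin (r + 1) → ZMod 2)} (hr : 2 ≤ r) (hl : 4 ≤ l)
    (hloc : HasLocality C r) (hdist : 5 ≤ minDist C)
    (hC : (finrank (ZMod 2) C : ℤ) = ⌊dimBound ((r + 1) * l) r⌋) : IsKOptimal C r := by
  have hcard : Fintype.card (Fin l × Fin (r + 1)) = (r + 1) * l := by simp [mul_comm]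
  refine ⟨hloc, hdist, hr, ?_, by rw [hcard, hC]⟩
  have hl' : (4 : ℝ) ≤ l := by exact_mod_cast hl
  rw [hcard]
  push_cast
  nlinarith

variable {b s t m z l : ℕ} {GU : Matrix (Fin s) (Fin s) (ZMod 2)}
  {W : Fin l → Submodule (ZMod 2) (Fin m → ZMod 2)} {e : ∀ i, Basis (Fin t) (ZMod 2) (W i)}
  {A₁ : Matrix (Fin s) (Fin (2 ^ b)) (ZMod 2)} {A₂ : Matrix (Fin t) (Fin (2 ^ b)) (ZMod 2)}

theorem finrank_spreadCode (ht : t ≠ 0) (htm : t ≤ m) (hl : 2 ^ (m - t) < l)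
    (hW : IsPartialSpread t W) (hGU : GU.rank = s) (hA : IsDesired A₁ A₂) :
    (finrank (ZMod 2) (spreadCode GU e A₁ A₂) : ℤ) = 2 ^ b * l - (s + m) := by
  have : Nonempty (Fin l) := Fin.pos_iff_nonempty.1 ((Nat.zero_le _).trans_lt hl)
  have hspan := hW.iSup_eq_top (two_pow_lt_two_mul_of_two_pow_sub_lt ht htm hl)
  have hdim := finrank_spreadCode_add (e := e) hspan hGU hA.full_rank
  zify at hdim
  linarith

theorem six_le_minDist_spreadCode (hb : 2 ≤ b) (hsb : s < b) (hst : s + t = 2 * b)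
    (hm : 2 * t ≤ m) (hm7 : 7 ≤ m) (hl : 2 ^ (m - t) < l)
    (hW : IsPartialSpread t W) (hGU : GU.rank = s) (hA : IsDesired A₁ A₂) :
    6 ≤ minDist (spreadCode GU e A₁ A₂) := by
  refine le_minDist (fun hbot => ?_) fun c =>
    six_le_hammingNorm_of_mem_spreadCode hW hGU hA (by omega) (Nat.pow_le_pow_right two_pos hb)
  have hdim := finrank_spreadCode (e := e) (by omega) (by omega) hl hW hGU hA
  have hlt := add_lt_two_pow_mul hb hsb hst hm hm7 hl
  rw [hbot, finrank_bot] at hdim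
  zify at hlt
  omega

theorem isKOptimal_spreadCode (hb : 2 ≤ b) (hsb : s < b) (hst : s + t = 2 * b)
    (hm : 2 * t + z ≤ m) (hm7 : 7 ≤ m)
    (hl : (l * (2 ^ t - 1) : ℤ) = 2 ^ m - 2 ^ t * (2 ^ z - 1) - 1)
    (hW : IsPartialSpread t W) (hGU : GU.rank = s) (hA : IsDesired A₁ A₂) :
    IsKOptimal (spreadCode GU e A₁ A₂) (2 ^ b) := by
  have hlt := two_pow_sub_lt_of_mul_sub_one_eq (by omega) hm hl
  have hfour : 2 ^ 2 ≤ 2 ^ (m - t) := Nat.pow_le_pow_right two_pos (by omega)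
  refine isKOptimal_of_finrank_eq_floor_dimBound (Nat.le_self_pow (by omega) 2) (by omega)
    hasLocality_parityCheckMatrix ?_ ?_
  · exact le_of_add_le_right
      (six_le_minDist_spreadCode hb hsb hst (by omega) hm7 hlt hW hGU hA : 5 + 1 ≤ _)
  · rw [floor_dimBound_of_mul_sub_one_eq hb hsb hst hm hm7 hl]
    exact finrank_spreadCode (by omega) (by omega) hlt hW hGU hA

end Optimality

end BinLRC

open BinLRC in
theorem theorem3_general (b s m z : ℕ) (hb : 2 ≤ b) (hsb : s < b) (hm : 2 * b - s + z < m)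
    (hm7 : 7 ≤ m) (hz : z ≡ m [MOD 2 * b - s]) :
    ∃ l : ℕ,
      (l : ℚ) = (2 ^ m - 2 ^ (2 * b - s) * (2 ^ z - 1) - 1) / (2 ^ (2 * b - s) - 1) ∧
      (∃ W : Fin l → Submodule (ZMod 2) (Fin m → ZMod 2), IsPartialSpread (2 * b - s) W) ∧
      ∀ (W : Fin l → Submodule (ZMod 2) (Fin m → ZMod 2)), IsPartialSpread (2 * b - s) W →
      ∀ (e : ∀ i, Module.Basis (Fin (2 * b - s)) (ZMod 2) (W i))
        (GU : Matrix (Fin s) (Fin s) (ZMod 2)), GU.rank = s →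
      ∀ (A₁ : Matrix (Fin s) (Fin (2 ^ b)) (ZMod 2))
        (A₂ : Matrix (Fin (2 * b - s)) (Fin (2 ^ b)) (ZMod 2)), IsDesired A₁ A₂ →
      ∃ n : ℕ, n = (2 ^ b + 1) * l ∧
        Fintype.card (Fin l × Fin (2 ^ b + 1)) = n ∧
        (Module.finrank (ZMod 2) (spreadCode GU e A₁ A₂) : ℤ) = n - l - s - m ∧
        6 ≤ minDist (spreadCode GU e A₁ A₂) ∧
        HasLocality (spreadCode GU e A₁ A₂) (2 ^ b) ∧
        HasDisjointRepairGroups (spreadCode GU e A₁ A₂) (2 ^ b) ∧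
        IsKOptimal (spreadCode GU e A₁ A₂) (2 ^ b) := by
  generalize ht : 2 * b - s = t at *
  obtain ⟨k, rfl⟩ := exists_eq_mul_add_of_modEq hz hm
  have htm : 2 * t + z ≤ t * (k + 1 + 1) + z := by nlinarith
  obtain ⟨l, hl, hspread⟩ := exists_hasPartialSpread (ZMod 2) (show t ≠ 0 by omega) z (k + 1)
  rw [Nat.card_zmod, Nat.cast_two] at hl
  have hlt := two_pow_sub_lt_of_mul_sub_one_eq (by omega) htm hl
  refine ⟨l, ?_, hasPartialSpread_zmod_two_iff.1 hspread, fun W hW e GU hGU A₁ A₂ hA => ?_⟩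
  · have ht0 : (2 ^ t - 1 : ℚ) ≠ 0 := sub_ne_zero.2 (one_lt_pow₀ one_lt_two (by omega)).ne'
    exact (eq_div_iff ht0).2 (by exact_mod_cast hl)
  have hdim := finrank_spreadCode (e := e) (by omega) (by omega) hlt hW hGU hA
  exact ⟨_, rfl, by simp [mul_comm], by rw [hdim]; push_cast; ring,
    six_le_minDist_spreadCode hb hsb (by omega) (by omega) hm7 hlt hW hGU hA,
    hasLocality_parityCheckMatrix, hasDisjointRepairGroups_parityCheckMatrix,
    isKOptimal_spreadCode hb hsb (by omega) htm hm7 hl hW hGU hA⟩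

open BinLRC in
theorem theorem3 (b s m z : ℕ) (hs : 1 ≤ s) (hsb : s < b) (hm : 4 * b ≤ m)
    (hdvd : ¬ (2 * b - s) ∣ m) (hz : z ≡ m [MOD 2 * b - s]) (hzb : z ≤ b) :
    ∃ l : ℕ,
      (l : ℚ) = (2 ^ m - 2 ^ (2 * b - s) * (2 ^ z - 1) - 1) / (2 ^ (2 * b - s) - 1) ∧
      (∃ W : Fin l → Submodule (ZMod 2) (Fin m → ZMod 2), IsPartialSpread (2 * b - s) W) ∧
      ∀ (W : Fin l → Submodule (ZMod 2) (Fin m → ZMod 2)), IsPartialSpread (2 * b - s) W →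
      ∀ (e : ∀ i, Module.Basis (Fin (2 * b - s)) (ZMod 2) (W i))
        (GU : Matrix (Fin s) (Fin s) (ZMod 2)), GU.rank = s →
      ∀ (A₁ : Matrix (Fin s) (Fin (2 ^ b)) (ZMod 2))
        (A₂ : Matrix (Fin (2 * b - s)) (Fin (2 ^ b)) (ZMod 2)), IsDesired A₁ A₂ →
      ∃ n : ℕ, n = (2 ^ b + 1) * l ∧
        Fintype.card (Fin l × Fin (2 ^ b + 1)) = n ∧
        (Module.finrank (ZMod 2) (spreadCode GU e A₁ A₂) : ℤ) = n - l - s - m ∧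
        6 ≤ minDist (spreadCode GU e A₁ A₂) ∧
        HasLocality (spreadCode GU e A₁ A₂) (2 ^ b) ∧
        HasDisjointRepairGroups (spreadCode GU e A₁ A₂) (2 ^ b) ∧
        IsKOptimal (spreadCode GU e A₁ A₂) (2 ^ b) :=
  theorem3_general b s m z (by omega) hsb (by omega) (by omega) hz
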